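/- Let $\mathcal{A}_{\mathbb{Z}[t]}:=\bigl(\prod_p (\mathbb{Z}/p\mathbb{Z})[t]\bigr)\big/\bigl(\bigoplus_p (\mathbb{Z}/p\mathbb{Z})[t]\bigr)$, where $p$ runs through all primes, so that two families $(f_p)_p$ and $(g_p)_p$ represent the same element if and only if $f_p=g_p$ for all but finitely many $p$; define $\mathcal{A}_{\mathbb{Z}[t_1,\ldots,t_r]}$ in the same way. Let $t^{\boldsymbol{p}}\in\mathcal{A}_{\mathbb{Z}[t]}$ be the class of $(t^p)_p$ and put $t^{2\boldsymbol{p}}:=(t^{\boldsymbol{p}})^2$. For an index $\mathbf{k}=(k_1,\ldots,k_r)$ of positive integers ($r\ge 1$), define the finite multiple polylogarithms of Sakugawa--Seki type $$ \pounds^{*}_{\mathcal{A}, \mathbf{k}}(t_1, \ldots, t_r):=\sum_{0<n_1<\cdots<n_r<p}\frac{t^{n_1}_1\cdots t^{n_r}_r}{n^{k_1}_1\cdots n^{k_r}_r }\bmod{p}\ \in \mathcal{A}_{\mathbb{Z}[t_1,\ldots,t_r]}, $$ $$ \pounds_{\mathcal{A}, \mathbf{k}}(t):=\pounds^*_{\mathcal{A},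 \mathbf{k}}(\underbrace{1,\ldots,1}_{r-1}, t),\qquad \widetilde{\pounds}_{\mathcal{A}, \mathbf{k}}(t):=\pounds^*_{\mathcal{A}, \mathbf{k}}(t, \underbrace{1,\ldots,1}_{r-1})\quad\text{in } \mathcal{A}_{\mathbb{Z}[t]}, $$ and write $\{1\}^4:=(1,1,1,1)$. Then the following equality holds in $\mathcal{A}_{\mathbb{Z}[t]}$: $$ \begin{aligned} &(1+4t^{\boldsymbol{p}}+t^{2\boldsymbol{p}})\pounds_{\mathcal{A}, \{1\}^4}(t)+2t^{\boldsymbol{p}}(2+t^{\boldsymbol{p}})\pounds^*_{\mathcal{A}, \{1\}^4}(1,1,t,1)+2t^{\boldsymbol{p}}(1+2t^{\boldsymbol{p}})\pounds^*_{\mathcal{A}, \{1\}^4}(1,t,1,1)\\ &+t^{\boldsymbol{p}}(1+4t^{\boldsymbol{p}}+t^{2\boldsymbol{p}})\widetilde{\pounds}_{\mathcal{A}, \{1\}^4}(t)+t^{\boldsymbol{p}}(1+3t^{\boldsymbol{p}})\widetilde{\pounds}_{\mathcal{A}, (2,1,1)}(t)+2t^{\boldsymbol{p}}(1+t^{\boldsymbol{p}})\pounds^*_{\mathcal{A},(1,2,1)}(1,t,1)\\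 &+t^{\boldsymbol{p}}(3+t^{\boldsymbol{p}})\pounds_{\mathcal{A},(1,1,2)}(t)+t^{\boldsymbol{p}}\Bigl(\pounds_{\mathcal{A},(2,1,1)}(t)+\pounds^*_{\mathcal{A},(2,1,1)}(1,t,1)+\pounds_{\mathcal{A},(1,2,1)}(t)+\pounds_{\mathcal{A},(2,2)}(t)\Bigr)\\ &+t^{2\boldsymbol{p}}\Bigl(\widetilde{\pounds}_{\mathcal{A},(1,1,2)}(t)+\pounds^*_{\mathcal{A},(1,1,2)}(1,t,1)+\widetilde{\pounds}_{\mathcal{A}, (1,2,1)}(t)+\widetilde{\pounds}_{\mathcal{A},(2,2)}(t)\Bigr)\\ ={}&(6-6t^{\boldsymbol{p}}+t^{2\boldsymbol{p}})\pounds_{\mathcal{A}, \{1\}^4}(1-t)+2(1-t^{\boldsymbol{p}})(3-t^{\boldsymbol{p}})\pounds^*_{\mathcal{A}, \{1\}^4}(1,1,1-t,1)\\ &+2(1-t^{\boldsymbol{p}})(3-2t^{\boldsymbol{p}})\pounds^*_{\mathcal{A}, \{1\}^4}(1,1-t,1,1)+(1-t^{\boldsymbol{p}})(6-6t^{\boldsymbol{p}}+t^{2\boldsymbol{p}})\widetilde{\pounds}_{\mathcal{A},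 \{1\}^4}(1-t)\\ &+(1-t^{\boldsymbol{p}})(4-3t^{\boldsymbol{p}})\widetilde{\pounds}_{\mathcal{A}, (2,1,1)}(1-t)+2(1-t^{\boldsymbol{p}})(2-t^{\boldsymbol{p}})\pounds^*_{\mathcal{A},(1,2,1)}(1,1-t,1)\\ &+(1-t^{\boldsymbol{p}})(4-t^{\boldsymbol{p}})\pounds_{\mathcal{A},(1,1,2)}(1-t)+(1-t^{\boldsymbol{p}})\Bigl(\pounds_{\mathcal{A},(2,1,1)}(1-t)+\pounds^*_{\mathcal{A},(2,1,1)}(1,1-t,1)\\ &\quad+\pounds_{\mathcal{A},(1,2,1)}(1-t)+\pounds_{\mathcal{A},(2,2)}(1-t)\Bigr)+(1-t^{\boldsymbol{p}})^2\Bigl(\widetilde{\pounds}_{\mathcal{A},(1,1,2)}(1-t)+\pounds^*_{\mathcal{A},(1,1,2)}(1,1-t,1)\\ &\quad+\widetilde{\pounds}_{\mathcal{A}, (1,2,1)}(1-t)+\widetilde{\pounds}_{\mathcal{A},(2,2)}(1-t)\Bigr). \end{aligned} $$ -/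

import Mathlib

open Polynomial

namespace FMP

/-- The ideal `⨁_p R p` of `∏_p R p`: families vanishing at all but finitely many primes. -/
def finiteSupport (R : Nat.Primes → Type) [∀ p, CommRing (R p)] : Ideal (∀ p, R p) where
  carrier := {f | {p | f p ≠ 0}.Finite}
  zero_mem' := by simp
  add_mem' := by
    intro f g hf hg
    refine (Set.Finite.union hf hg).subset ?_
    intro p hp
    by_contra h
    simp only [Set.mem_union, Set.mem_ofPred_eq, not_or, not_not] at h
    exact hp (by simp [h.1, h.2])
  smul_mem' := by
    intro c f hf
    refine Set.Finite.subset hf ?_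
    intro p hp h
    exact hp (by simp [h])

/-- The quotient ring `(∏_p R p) / (⨁_p R p)`. -/
abbrev Adele (R : Nat.Primes → Type) [∀ p, CommRing (R p)] : Type :=
  (∀ p, R p) ⧸ finiteSupport R

/-- The class of a family in the quotient. -/
def mk {R : Nat.Primes → Type} [∀ p, CommRing (R p)] (f : ∀ p, R p) : Adele R :=
  Ideal.Quotient.mk (finiteSupport R) f

/-- The ring homomorphism of quotients induced by a family of ring homomorphisms. -/
noncomputable def map {R S : Nat.Primes → Type} [∀ p, CommRing (R p)] [∀ p, CommRing (S p)]
    (φ : ∀ p, R p →+* S p) : Adele R →+* Adele S :=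
  Ideal.quotientMap (finiteSupport S)
    (RingHom.pi fun p => (φ p).comp (Pi.evalRingHom R p)) (by
      intro f hf
      refine Set.Finite.subset (s := {p | f p ≠ 0}) hf ?_
      intro p hp h
      exact hp ((congrArg (φ p) h).trans (map_zero (φ p))))

/-- The ring `𝒜_{ℤ[t]}`. -/
abbrev APoly : Type := Adele fun p => (ZMod p)[X]

/-- The ring `𝒜_{ℤ[t_1, …, t_r]}`. -/
abbrev AMvPoly (r : ℕ) : Type := Adele fun p => MvPolynomial (Fin r) (ZMod p)

/-- The element `t^𝐩`, that is, the class of the family `(t^p)_p`. -/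
noncomputable def tp : APoly := mk fun p => (X : (ZMod p)[X]) ^ (p : ℕ)

/-- Tuples of integers `0 < n_1 < ⋯ < n_r < p`. -/
def tuples (r p : ℕ) : Finset (Fin r → ℕ) :=
  (Fintype.piFinset fun _ : Fin r => Finset.Ioo 0 p).filter fun n => ∀ i j, i < j → n i < n j

/-- The finite harmonic multiple polylogarithm
`∑_{0 < n_1 < ⋯ < n_r < p} t_1^{n_1} ⋯ t_r^{n_r} / (n_1^{k_1} ⋯ n_r^{k_r}) mod p`
in the variables `t_1, …, t_r`. -/
noncomputable def harmonic {r : ℕ} (k : Fin r → ℕ) : AMvPoly r :=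
  mk fun p => ∑ n ∈ tuples r p,
    MvPolynomial.C (∏ i, ((n i : ZMod p) ^ k i)⁻¹) * ∏ i, MvPolynomial.X i ^ n i

/-- Substitution of one-variable integral polynomials `u_1, …, u_r` (reduced modulo each `p`)
for the variables `t_1, …, t_r`. -/
noncomputable def subst {r : ℕ} (u : Fin r → ℤ[X]) : AMvPoly r →+* APoly :=
  map fun p => MvPolynomial.eval₂Hom (C : ZMod p →+* (ZMod p)[X])
    fun i => (u i).map (Int.castRingHom (ZMod p))

/-- `£*_{𝒜, k}(u_1, …, u_r)`. -/
noncomputable def star {r : ℕ} (k : Fin r → ℕ) (u : Fin r → ℤ[X]) : APoly :=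
  subst u (harmonic k)

/-- `£_{𝒜, k}(u) = £*_{𝒜, k}(1, …, 1, u)`. -/
noncomputable def polylog {r : ℕ} (k : Fin (r + 1) → ℕ) (u : ℤ[X]) : APoly :=
  star k (Fin.snoc (fun _ : Fin r => (1 : ℤ[X])) u)

/-- `£~_{𝒜, k}(u) = £*_{𝒜, k}(u, 1, …, 1)`. -/
noncomputable def tildePolylog {r : ℕ} (k : Fin (r + 1) → ℕ) (u : ℤ[X]) : APoly :=
  star k (Fin.cons u (fun _ : Fin r => (1 : ℤ[X])))

end FMP

/-! Fix a prime `p > 5`, put `T = X ^ p`, and let `G_r = chainPoly p r` be the generating polynomial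
of chains of `r + 1` elements weighted by `T` to the number of descents. Both sides of the theorem
are the same expression `chamberSum`, at `(T, X)` and at `(1 - T, 1 - X)`. For each of these pairs
it equals the chain sum of depth four, so the theorem says that `G_3` is invariant under `X ↦ 1 -
X`; note `(1 - X) ^ p = 1 - T`.

Invariance comes from differentiation, for which `T` is a constant. With `g = G_0` one has `g' = (1
- X) ^ (p - 1) - X ^ (p - 1)`, which reflection negates, and `G_{r+1}' = G_r g'` up to an error `X ^
(p - 1) * K` with `K' = 0`. Such a term is a derivative only if `K = 0`
(`eq_zero_of_derivative_eq_X_pow_mul`). This kills the error as soon as `G_r g'` has an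
antiderivative, and likewise the constant of integration in `G_r(1 - X) - G_r(X)`. For small `r`,
`G_r` is a combination of divided powers of `g`, so the antiderivatives exist.

The passage from chains to ordered sums is combinatorial: classify a chain by the order type of its
entries and count descents (`symmetrize_descentWeight`). -/

namespace FMP

/-! ### Descent-weighted chains and their order types -/

section Chain

variable {R : Type*} [CommRing R]

/-- The factor recording whether a step of a chain is an ascent, a descent or stationary. -/
def descentWeight (T : R) (m n : ℕ) : R := if m < n then 1 else if n < m then T else 0

/-- The sum over chains `n_1, …, n_{r+1} = n` in `(0, N)` with distinct neighbours of
`T ^ (number of descents) * a n_1 ⋯ a n_{r+1}`. -/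
def chainCoeff (a : ℕ → R) (T : R) (N : ℕ) : ℕ → ℕ → R
  | 0, n => a n
  | r + 1, n => a n * ∑ m ∈ Finset.Ioo 0 N, descentWeight T m n * chainCoeff a T N r m

/-- The generating polynomial of `chainCoeff`, evaluated at `u`. -/
def chainSum (a : ℕ → R) (T : R) (N : ℕ) (u : R) (r : ℕ) : R :=
  ∑ n ∈ Finset.Ioo 0 N, chainCoeff a T N r n * u ^ n

lemma map_chainCoeff {S : Type*} [CommRing S] (φ : R →+* S) (a : ℕ → R) (T : R) (N r n : ℕ) :
    φ (chainCoeff a T N r n) = chainCoeff (fun k => φ (a k)) (φ T) N r n := by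
  induction r generalizing n with
  | zero => rfl
  | succ r ih =>
    simp only [chainCoeff, map_mul, map_sum, ih, descentWeight, apply_ite φ, map_one, map_zero]

lemma map_chainSum {S : Type*} [CommRing S] (φ : R →+* S) (a : ℕ → R) (T : R) (N : ℕ) (u : R)
    (r : ℕ) : φ (chainSum a T N u r) = chainSum (fun k => φ (a k)) (φ T) N (φ u) r := by
  simp only [chainSum, map_sum, map_mul, map_pow, map_chainCoeff]

/-- Symmetrization of a function of three variables. -/
def symmetrize (f : ℕ → ℕ → ℕ → R) (x y z : ℕ) : R :=
  f x y z + f x z y + f y x z + f y z x + f z x y + f z y x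

lemma sum_symmetrize (s : Finset ℕ) (f : ℕ → ℕ → ℕ → R) :
    ∑ x ∈ s, ∑ y ∈ s, ∑ z ∈ s, symmetrize f x y z = 6 * ∑ x ∈ s, ∑ y ∈ s, ∑ z ∈ s, f x y z := by
  have swap (g : ℕ → ℕ → ℕ → R) :
      ∑ x ∈ s, ∑ y ∈ s, ∑ z ∈ s, g x z y = ∑ x ∈ s, ∑ y ∈ s, ∑ z ∈ s, g x y z :=
    Finset.sum_congr rfl fun _ _ => Finset.sum_comm
  have swap' (g : ℕ → ℕ → ℕ → R) :
      ∑ x ∈ s, ∑ y ∈ s, ∑ z ∈ s, g y x z = ∑ x ∈ s, ∑ y ∈ s, ∑ z ∈ s, g x y z :=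
    Finset.sum_comm
  simp only [symmetrize, Finset.sum_add_distrib]
  rw [swap f, swap' f, swap' (fun x y z => f x z y), swap f, swap (fun x y z => f y x z), swap' f,
    swap' (fun x y z => f z x y), swap (fun x y z => f y x z), swap' f]
  ring

/-- The weight with which the ordered and partially collapsed chains contribute. -/
def chamberWeight (T : R) (n x y z : ℕ) : R :=
  (1 + 4 * T + T ^ 2) * (if x < y ∧ y < z ∧ z < n then 1 else 0)
  + 2 * T * (2 + T) * (if x < y ∧ y < n ∧ n < z then 1 else 0)
  + 2 * T * (1 + 2 * T) * (if x < n ∧ n < y ∧ y < z then 1 else 0)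
  + T * (1 + 4 * T + T ^ 2) * (if n < x ∧ x < y ∧ y < z then 1 else 0)
  + T * (1 + 3 * T) * (if z = n then if n < x ∧ x < y then 1 else 0 else 0)
  + 2 * T * (1 + T) * (if z = n then if x < n ∧ n < y then 1 else 0 else 0)
  + T * (3 + T) * (if z = n then if x < y ∧ y < n then 1 else 0 else 0)
  + T * ((if z = x then if x < y ∧ y < n then 1 else 0 else 0)
    + (if z = x then if x < n ∧ n < y then 1 else 0 else 0)
    + (if z = y then if x < y ∧ y < n then 1 else 0 else 0)
    + (if z = n then if y = x then if x < n then 1 else 0 else 0 else 0))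
  + T ^ 2 * ((if z = y then if n < x ∧ x < y then 1 else 0 else 0)
    + (if z = y then if x < n ∧ n < y then 1 else 0 else 0)
    + (if z = x then if n < x ∧ x < y then 1 else 0 else 0)
    + (if z = n then if y = x then if n < x then 1 else 0 else 0 else 0))

lemma symmetrize_swap_left (f : ℕ → ℕ → ℕ → R) (x y z : ℕ) :
    symmetrize f y x z = symmetrize f x y z := by
  simp only [symmetrize]; ring

lemma symmetrize_swap_right (f : ℕ → ℕ → ℕ → R) (x y z : ℕ) :
    symmetrize f x z y = symmetrize f x y z := by
  simp only [symmetrize]; ring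

-- Only the order type of `x, y, z, n` matters, which leaves finitely many polynomial identities in
-- `T`. If `x < y < z < n`, the last step is an ascent and the six arrangements of `x, y, z` give
-- the Eulerian polynomial `1 + 4 * T + T ^ 2`; the other coefficients of `chamberWeight` are
-- descent counts of the same kind. Coincident entries are overcounted equally on both sides.
set_option maxHeartbeats 4000000 in
lemma symmetrize_descentWeight_of_le (T : R) {n x y z : ℕ} (hxy : x ≤ y) (hyz : y ≤ z) :
    symmetrize (fun x y z => descentWeight T x y * descentWeight T y z * descentWeight T z n) x y z
      = symmetrize (chamberWeight T n) x y z := by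
  simp only [symmetrize, descentWeight, chamberWeight]
  rcases hxy.lt_or_eq with h1 | h1 <;> rcases hyz.lt_or_eq with h2 | h2 <;>
  rcases lt_trichotomy x n with h3 | h3 | h3 <;> rcases lt_trichotomy y n with h4 | h4 | h4 <;>
  rcases lt_trichotomy z n with h5 | h5 | h5 <;>
  first
  | (exfalso; omega)
  | (simp (disch := omega) only [if_pos, if_neg]; ring)

/-- Both sides are symmetric in `x, y, z`, so these may be sorted. -/
lemma symmetrize_descentWeight (T : R) (n x y z : ℕ) :
    symmetrize (fun x y z => descentWeight T x y * descentWeight T y z * descentWeight T z n) x y z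
      = symmetrize (chamberWeight T n) x y z := by
  have key {x y z : ℕ} := symmetrize_descentWeight_of_le (R := R) T (n := n) (x := x) (y := y)
    (z := z)
  rcases le_total x y with h1 | h1 <;> rcases le_total y z with h2 | h2 <;>
    rcases le_total x z with h3 | h3
  · exact key h1 h2
  · exact key h1 h2
  · rw [← symmetrize_swap_right, key h3 h2, symmetrize_swap_right]
  · rw [← symmetrize_swap_right, ← symmetrize_swap_left, key h3 h1, symmetrize_swap_left,
      symmetrize_swap_right]
  · rw [← symmetrize_swap_left, key h1 h3, symmetrize_swap_left]
  · rw [← symmetrize_swap_left, ← symmetrize_swap_right, key h2 h3, symmetrize_swap_right,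
      symmetrize_swap_left]
  all_goals
    rw [← symmetrize_swap_left, ← symmetrize_swap_right, ← symmetrize_swap_left, key h2 h1,
      symmetrize_swap_left, symmetrize_swap_right, symmetrize_swap_left]

end Chain
end FMP

/-! ### Differentiation modulo `p` and the reflection `X ↦ 1 - X` -/

namespace FMP

section Derivative

variable {p : ℕ} [hp : Fact p.Prime]

lemma derivative_X_pow_char : derivative ((X : (ZMod p)[X]) ^ p) = 0 := by
  simp [derivative_X_pow]

lemma coeff_eq_zero_of_derivative_eq_zero {K : (ZMod p)[X]} (hK : derivative K = 0) {n : ℕ}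
    (hn : ¬ p ∣ n) : K.coeff n = 0 := by
  obtain ⟨m, rfl⟩ : ∃ m, n = m + 1 := ⟨n - 1, by
    have : n ≠ 0 := fun h => hn (h ▸ dvd_zero p)
    omega⟩
  have h := congrArg (fun q => q.coeff m) hK
  simp only [coeff_derivative, coeff_zero] at h
  refine (mul_eq_zero.mp h).resolve_right fun h0 => hn ?_
  exact (ZMod.natCast_eq_zero_iff (m + 1) p).mp (by exact_mod_cast h0)

/-- `K` involves only exponents divisible by `p`, so `X ^ (p - 1) * K` involves only exponents
congruent to `-1`, and these never occur in a derivative. -/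
lemma eq_zero_of_derivative_eq_X_pow_mul {K ψ : (ZMod p)[X]} (hK : derivative K = 0)
    (hψ : derivative ψ = X ^ (p - 1) * K) : K = 0 := by
  ext n
  by_cases hn : p ∣ n
  · have h := congrArg (fun q => q.coeff (n + (p - 1))) hψ
    simp only [coeff_derivative, coeff_X_pow_mul] at h
    have h1 : n + (p - 1) + 1 = n + p := by have := hp.out.pos; omega
    have h0 : (((n + (p - 1) : ℕ) : ZMod p) + 1) = 0 := by
      rw [← Nat.cast_succ, Nat.succ_eq_add_one, h1, ZMod.natCast_eq_zero_iff]
      exact dvd_add hn dvd_rfl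
    rw [h0, mul_zero] at h
    simpa using h.symm
  · simpa using coeff_eq_zero_of_derivative_eq_zero hK hn

lemma derivative_mul_of_derivative_eq_zero {K : (ZMod p)[X]} (hK : derivative K = 0)
    (f : (ZMod p)[X]) : derivative (K * f) = K * derivative f := by
  rw [derivative_mul, hK, zero_mul, zero_add]

/-- The family of inverses of the natural numbers, as constant polynomials modulo `p`. -/
noncomputable def invC (p : ℕ) (n : ℕ) : (ZMod p)[X] := C ((n : ZMod p)⁻¹)

lemma natCast_mul_invC {n : ℕ} (hn : n ∈ Finset.Ioo 0 p) : (n : (ZMod p)[X]) * invC p n = 1 := by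
  rw [Finset.mem_Ioo] at hn
  have h : (n : ZMod p) ≠ 0 := by
    rw [Ne, ZMod.natCast_eq_zero_iff]
    exact Nat.not_dvd_of_pos_of_lt hn.1 hn.2
  rw [invC, ← C_eq_natCast, ← C_mul, mul_inv_cancel₀ h, C_1]

lemma derivative_descentWeight (m n : ℕ) :
    derivative (descentWeight ((X : (ZMod p)[X]) ^ p) m n) = 0 := by
  unfold descentWeight
  split_ifs
  · exact derivative_one
  · exact derivative_X_pow_char
  · exact derivative_zero

lemma derivative_chainCoeff (r n : ℕ) :
    derivative (chainCoeff (invC p) (X ^ p) p r n) = 0 := by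
  induction r generalizing n with
  | zero => simp [chainCoeff, invC]
  | succ r ih =>
    simp [chainCoeff, invC, derivative_mul, ih, derivative_descentWeight]

/-- The chain sum of depth `r + 1` modulo `p`, with variable `X` and descent parameter `X ^ p`. -/
noncomputable def chainPoly (p r : ℕ) : (ZMod p)[X] := chainSum (invC p) (X ^ p) p X r

lemma X_mul_derivative_chainPoly (r : ℕ) :
    X * derivative (chainPoly p r)
      = ∑ n ∈ Finset.Ioo 0 p, chainCoeff (invC p) (X ^ p) p r n * (n : (ZMod p)[X]) * X ^ n := by
  simp only [chainPoly, chainSum, derivative_sum, Finset.mul_sum]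
  refine Finset.sum_congr rfl fun n hn => ?_
  rw [derivative_mul_of_derivative_eq_zero (derivative_chainCoeff r n), derivative_X_pow,
    C_eq_natCast]
  obtain ⟨m, rfl⟩ : ∃ m, n = m + 1 := ⟨n - 1, by rw [Finset.mem_Ioo] at hn; omega⟩
  rw [Nat.add_sub_cancel, pow_succ]
  ring

lemma X_mul_derivative_chainPoly_zero :
    X * derivative (chainPoly p 0) = ∑ n ∈ Finset.Ioo 0 p, (X : (ZMod p)[X]) ^ n := by
  rw [X_mul_derivative_chainPoly]
  refine Finset.sum_congr rfl fun n hn => ?_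
  rw [chainCoeff, mul_comm (invC p n), natCast_mul_invC hn, one_mul]

/-- The exponent `m + l` runs through a full period modulo `N` except `m` itself. Below `N` it is an
ascent from `m`, at `N` it gives the extra `u ^ N`, and above `N` it wraps around to a descent with
factor `u ^ N`. This is why the descent parameter is taken to be `X ^ p`. -/
lemma sum_descentWeight_mul_pow {R : Type*} [CommRing R] (u : R) {m N : ℕ}
    (hm : m ∈ Finset.Ioo 0 N) :
    ∑ l ∈ Finset.Ioo 0 N, u ^ (m + l)
      = ∑ n ∈ Finset.Ioo 0 N, descentWeight (u ^ N) m n * u ^ n + u ^ N := by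
  rw [Finset.mem_Ioo] at hm
  obtain ⟨k, rfl⟩ := Nat.exists_eq_add_of_le hm.2.le
  have e (a b : ℕ) : Finset.Ioo a b = Finset.Ico (a + 1) b := by ext; simp
  rw [e, ← Finset.sum_Ico_consecutive (fun l => u ^ (m + l)) (show 0 + 1 ≤ k by omega)
      (show k ≤ m + k by omega), ← Finset.sum_Ico_consecutive
      (fun n => descentWeight (u ^ (m + k)) m n * u ^ n) (show 0 + 1 ≤ m by omega)
      (show m ≤ m + k by omega),
    Finset.sum_eq_sum_Ico_succ_bot (show m < m + k by omega),
    Finset.sum_eq_sum_Ico_succ_bot (show k < m + k by omega)]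
  have h1 : ∑ l ∈ Finset.Ico (0 + 1) k, u ^ (m + l)
      = ∑ n ∈ Finset.Ico (m + 1) (m + k), descentWeight (u ^ (m + k)) m n * u ^ n := by
    rw [Finset.sum_Ico_add (fun k => u ^ k), show 0 + 1 + m = m + 1 by omega, add_comm k m]
    refine Finset.sum_congr rfl fun n hn => ?_
    rw [Finset.mem_Ico] at hn
    rw [descentWeight, if_pos (by omega), one_mul]
  have h2 : ∑ l ∈ Finset.Ico (k + 1) (m + k), u ^ (m + l)
      = ∑ n ∈ Finset.Ico (0 + 1) m, descentWeight (u ^ (m + k)) m n * u ^ n := by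
    rw [show k + 1 = 0 + 1 + k by omega, ← Finset.sum_Ico_add']
    refine Finset.sum_congr rfl fun n hn => ?_
    rw [Finset.mem_Ico] at hn
    rw [descentWeight, if_neg (by omega), if_pos (by omega), ← pow_add]
    congr 1
    omega
  rw [h1, h2]
  simp only [descentWeight, lt_self_iff_false, if_false, zero_mul]
  ring

lemma derivative_chainPoly_succ (r : ℕ) :
    derivative (chainPoly p (r + 1)) = chainPoly p r * derivative (chainPoly p 0)
      - X ^ (p - 1) * ∑ m ∈ Finset.Ioo 0 p, chainCoeff (invC p) (X ^ p) p r m := by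
  apply mul_left_cancel₀ (X_ne_zero : (X : (ZMod p)[X]) ≠ 0)
  rw [mul_sub, ← mul_assoc X (X ^ (p - 1)), ← pow_succ',
    Nat.sub_add_cancel hp.out.one_le, mul_left_comm, X_mul_derivative_chainPoly_zero,
    X_mul_derivative_chainPoly, chainPoly, chainSum, Finset.sum_mul_sum, eq_sub_iff_add_eq]
  have h (n : ℕ) (hn : n ∈ Finset.Ioo 0 p) :
      chainCoeff (invC p) (X ^ p) p (r + 1) n * (n : (ZMod p)[X]) * X ^ n
        = ∑ m ∈ Finset.Ioo 0 p, chainCoeff (invC p) (X ^ p) p r m *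
          (descentWeight (X ^ p) m n * X ^ n) := by
    rw [chainCoeff, mul_right_comm (invC p n), mul_comm (invC p n), natCast_mul_invC hn, one_mul,
      Finset.sum_mul]
    exact Finset.sum_congr rfl fun m _ => by ring
  rw [Finset.sum_congr rfl h, Finset.sum_comm, Finset.mul_sum, ← Finset.sum_add_distrib]
  refine Finset.sum_congr rfl fun m hm => ?_
  rw [← Finset.mul_sum, mul_comm (X ^ p), ← mul_add, ← sum_descentWeight_mul_pow X hm,
    Finset.mul_sum]
  exact Finset.sum_congr rfl fun l _ => by rw [pow_add, mul_assoc]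

lemma derivative_chainPoly_zero :
    derivative (chainPoly p 0) = (1 - X) ^ (p - 1) - X ^ (p - 1) := by
  apply mul_left_cancel₀ (X_ne_zero : (X : (ZMod p)[X]) ≠ 0)
  rw [X_mul_derivative_chainPoly_zero]
  have h1 : (1 - X : (ZMod p)[X]) ≠ 0 := fun h => by
    have := congrArg (eval 0) h
    simp at this
  apply mul_left_cancel₀ h1
  have e : Finset.Ioo 0 p = Finset.Ico 1 p := by ext; simp [Nat.succ_le_iff]
  have h2 : (1 - X : (ZMod p)[X]) * ∑ n ∈ Finset.Ico 1 p, X ^ n = X - X ^ p := by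
    have := geom_sum_Ico_mul (X : (ZMod p)[X]) hp.out.one_le
    linear_combination -this
  have h3 : (1 - X : (ZMod p)[X]) * (1 - X) ^ (p - 1) = 1 - X ^ p := by
    rw [← pow_succ', Nat.sub_add_cancel hp.out.one_le, sub_pow_char, one_pow]
  have h4 : (X : (ZMod p)[X]) * X ^ (p - 1) = X ^ p := by
    rw [← pow_succ', Nat.sub_add_cancel hp.out.one_le]
  rw [e, h2]
  linear_combination (-X) * h3 + (1 - X) * h4

/-- Reflection `X ↦ 1 - X`. -/
noncomputable def reflect (p : ℕ) : (ZMod p)[X] →+* (ZMod p)[X] := compRingHom (1 - X)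

lemma derivative_reflect (f : (ZMod p)[X]) :
    derivative (reflect p f) = -reflect p (derivative f) := by
  simp [reflect, derivative_comp]

lemma reflect_X : reflect p X = 1 - X := by simp [reflect]

lemma exists_derivative_eq_X_pow_mul_chainPoly (r : ℕ) :
    ∃ ψ, derivative ψ = X ^ (p - 1) * chainPoly p r := by
  -- Termwise integration of `X ^ (p - 1 + n)`: the denominator `p + n` is `n` modulo `p`, hence
  -- invertible.
  refine ⟨∑ n ∈ Finset.Ioo 0 p, chainCoeff (invC p) (X ^ p) p r n * (invC p n * X ^ (p + n)), ?_⟩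
  rw [derivative_sum, chainPoly, chainSum, Finset.mul_sum]
  refine Finset.sum_congr rfl fun n hn => ?_
  rw [derivative_mul_of_derivative_eq_zero (derivative_chainCoeff r n),
    derivative_mul_of_derivative_eq_zero (by simp [invC]), derivative_X_pow, C_eq_natCast]
  have h := natCast_mul_invC hn
  push_cast
  rw [CharP.cast_eq_zero, zero_add,
    show p + n - 1 = p - 1 + n by have := hp.out.pos; omega, pow_add]
  linear_combination chainCoeff (invC p) (X ^ p) p r n * X ^ (p - 1) * X ^ n * h

/-- A chain polynomial is reflection invariant as soon as the right derivatives exist. -/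
lemma reflect_chainPoly {r : ℕ} {ψ : (ZMod p)[X]}
    (hψ : derivative ψ = chainPoly p r * derivative (chainPoly p 0))
    (hr : reflect p (derivative (chainPoly p r)) = -derivative (chainPoly p r)) :
    reflect p (chainPoly p r) = chainPoly p r := by
  obtain ⟨χ, hχ⟩ := exists_derivative_eq_X_pow_mul_chainPoly (p := p) r
  rw [← sub_eq_zero]
  -- `ψ + χ` is an antiderivative of `(1 - X) ^ (p - 1) * chainPoly p r`, so `-reflect p (ψ + χ)` is
  -- one of `X ^ (p - 1) * reflect p (chainPoly p r)`.
  refine eq_zero_of_derivative_eq_X_pow_mul (ψ := -reflect p (ψ + χ) - χ) ?_ ?_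
  · rw [derivative_sub, derivative_reflect, hr, neg_neg, sub_self]
  · rw [derivative_sub, derivative_neg, derivative_reflect, derivative_add, hψ, hχ,
      derivative_chainPoly_zero]
    simp only [map_add, map_sub, map_mul, map_pow, map_one, reflect_X]
    ring

/-- The error term of `derivative_chainPoly_succ` is a difference of two derivatives, so its
coefficient vanishes. -/
lemma derivative_chainPoly_succ_of_exists {r : ℕ} {ψ : (ZMod p)[X]}
    (hψ : derivative ψ = chainPoly p r * derivative (chainPoly p 0)) :
    derivative (chainPoly p (r + 1)) = chainPoly p r * derivative (chainPoly p 0) := by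
  have h := derivative_chainPoly_succ (p := p) r
  have h0 : ∑ m ∈ Finset.Ioo 0 p, chainCoeff (invC p) (X ^ p) p r m = 0 := by
    refine eq_zero_of_derivative_eq_X_pow_mul (ψ := ψ - chainPoly p (r + 1)) ?_ ?_
    · rw [derivative_sum]
      exact Finset.sum_eq_zero fun m _ => derivative_chainCoeff r m
    · rw [derivative_sub, h, hψ]; ring
  rw [h, h0, mul_zero, sub_zero]

lemma reflect_derivative_chainPoly_zero :
    reflect p (derivative (chainPoly p 0)) = -derivative (chainPoly p 0) := by
  rw [derivative_chainPoly_zero]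
  simp only [map_sub, map_pow, map_one, reflect_X]
  ring

lemma exists_C_mul_natCast_eq_one {n : ℕ} (h0 : 0 < n) (hn : n < p) :
    ∃ c : ZMod p, C c * (n : (ZMod p)[X]) = 1 :=
  ⟨(n : ZMod p)⁻¹, by
    rw [mul_comm]
    exact natCast_mul_invC (Finset.mem_Ioo.mpr ⟨h0, hn⟩)⟩

/-- The chain polynomial of depth four is invariant under `X ↦ 1 - X`. -/
lemma reflect_chainPoly_three (h5 : 5 < p) : reflect p (chainPoly p 3) = chainPoly p 3 := by
  obtain ⟨c₂, hc₂⟩ := exists_C_mul_natCast_eq_one (p := p) (n := 2) (by omega) (by omega)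
  obtain ⟨c₃, hc₃⟩ := exists_C_mul_natCast_eq_one (p := p) (n := 3) (by omega) (by omega)
  obtain ⟨c₄, hc₄⟩ := exists_C_mul_natCast_eq_one (p := p) (n := 4) (by omega) (by omega)
  obtain ⟨c₅, hc₅⟩ := exists_C_mul_natCast_eq_one (p := p) (n := 5) (by omega) h5
  push_cast at hc₂ hc₃ hc₄ hc₅
  set g := chainPoly p 0 with hg
  have step {r : ℕ} {ψ : (ZMod p)[X]} (hψ : derivative ψ = chainPoly p r * derivative g)
      (hr : reflect p (chainPoly p r) = chainPoly p r) :
      reflect p (derivative (chainPoly p (r + 1))) = -derivative (chainPoly p (r + 1)) := by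
    rw [derivative_chainPoly_succ_of_exists hψ, map_mul, hr, reflect_derivative_chainPoly_zero,
      mul_neg]
  -- From here on `C c₂ * g ^ 2` is `g ^ 2 / 2!`, `C c₂ * C c₃ * g ^ 3` is `g ^ 3 / 3!`, and so on;
  -- the `K i` are constants of integration.
  have e₀ : derivative (C c₂ * g ^ 2) = g * derivative g := by
    simp only [derivative_mul, derivative_C, derivative_pow, map_ofNat, Nat.cast_ofNat]
    linear_combination g * derivative g * hc₂
  have d₁ := derivative_chainPoly_succ_of_exists e₀
  have s₁ := step e₀ (reflect_chainPoly e₀ reflect_derivative_chainPoly_zero)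
  obtain ⟨K₁, hK₁, k₁⟩ : ∃ K, derivative K = 0 ∧ chainPoly p 1 = C c₂ * g ^ 2 + K :=
    ⟨chainPoly p 1 - C c₂ * g ^ 2, by rw [derivative_sub, d₁, e₀, sub_self], by ring⟩
  have e₁ : derivative (C c₂ * C c₃ * g ^ 3 + K₁ * g) = chainPoly p 1 * derivative g := by
    simp only [k₁, hK₁, derivative_add, derivative_mul, derivative_C, derivative_pow, map_ofNat,
      Nat.cast_ofNat]
    linear_combination C c₂ * g ^ 2 * derivative g * hc₃
  have d₂ := derivative_chainPoly_succ_of_exists e₁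
  have s₂ := step e₁ (reflect_chainPoly e₁ s₁)
  obtain ⟨K₂, hK₂, k₂⟩ : ∃ K, derivative K = 0 ∧
      chainPoly p 2 = C c₂ * C c₃ * g ^ 3 + K₁ * g + K :=
    ⟨chainPoly p 2 - (C c₂ * C c₃ * g ^ 3 + K₁ * g), by rw [derivative_sub, d₂, e₁, sub_self],
      by ring⟩
  have e₂ : derivative (C c₂ * C c₃ * C c₄ * g ^ 4 + K₁ * C c₂ * g ^ 2 + K₂ * g)
      = chainPoly p 2 * derivative g := by
    simp only [k₂, hK₁, hK₂, derivative_add, derivative_mul, derivative_C, derivative_pow,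
      map_ofNat, Nat.cast_ofNat]
    linear_combination C c₂ * C c₃ * g ^ 3 * derivative g * hc₄ + K₁ * g * derivative g * hc₂
  have d₃ := derivative_chainPoly_succ_of_exists e₂
  have s₃ := step e₂ (reflect_chainPoly e₂ s₂)
  obtain ⟨K₃, hK₃, k₃⟩ : ∃ K, derivative K = 0 ∧
      chainPoly p 3 = C c₂ * C c₃ * C c₄ * g ^ 4 + K₁ * C c₂ * g ^ 2 + K₂ * g + K :=
    ⟨chainPoly p 3 - (C c₂ * C c₃ * C c₄ * g ^ 4 + K₁ * C c₂ * g ^ 2 + K₂ * g),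
      by rw [derivative_sub, d₃, e₂, sub_self], by ring⟩
  -- Invariance at depth four still needs an antiderivative of `chainPoly p 3 * derivative g`; its
  -- term `g ^ 5 / 5!` forces `5 < p`.
  have e₃ : derivative (C c₂ * C c₃ * C c₄ * C c₅ * g ^ 5 + K₁ * C c₂ * C c₃ * g ^ 3
      + K₂ * C c₂ * g ^ 2 + K₃ * g) = chainPoly p 3 * derivative g := by
    simp only [k₃, hK₁, hK₂, hK₃, derivative_add, derivative_mul, derivative_C, derivative_pow,
      map_ofNat, Nat.cast_ofNat]
    linear_combination C c₂ * C c₃ * C c₄ * g ^ 4 * derivative g * hc₅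
      + K₁ * C c₂ * g ^ 2 * derivative g * hc₃ + K₂ * g * derivative g * hc₂
  exact reflect_chainPoly e₃ s₃

end Derivative
end FMP

/-! ### Sums over increasing tuples as weighted sums over quadruples -/

namespace FMP

section OrderedSums

variable {R : Type*} [CommRing R]

/-- The combination, with coefficients in the descent parameter `T`, of the sums `S k j` of
exponents `k` with the variable at position `j`. -/
def chamberSum (T : R) (S : ∀ r : ℕ, (Fin r → ℕ) → Fin r → R) : R :=
  (1 + 4 * T + T ^ 2) * S 4 ![1, 1, 1, 1] 3
  + 2 * T * (2 + T) * S 4 ![1, 1, 1, 1] 2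
  + 2 * T * (1 + 2 * T) * S 4 ![1, 1, 1, 1] 1
  + T * (1 + 4 * T + T ^ 2) * S 4 ![1, 1, 1, 1] 0
  + T * (1 + 3 * T) * S 3 ![2, 1, 1] 0
  + 2 * T * (1 + T) * S 3 ![1, 2, 1] 1
  + T * (3 + T) * S 3 ![1, 1, 2] 2
  + T * (S 3 ![2, 1, 1] 2 + S 3 ![2, 1, 1] 1 + S 3 ![1, 2, 1] 2 + S 2 ![2, 2] 1)
  + T ^ 2 * (S 3 ![1, 1, 2] 0 + S 3 ![1, 1, 2] 1 + S 3 ![1, 2, 1] 0 + S 2 ![2, 2] 0)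

lemma map_chamberSum {R' : Type*} [CommRing R'] (φ : R →+* R') (T : R)
    (S : ∀ r : ℕ, (Fin r → ℕ) → Fin r → R) :
    φ (chamberSum T S) = chamberSum (φ T) fun r k j => φ (S r k j) := by
  simp only [chamberSum, map_add, map_mul, map_pow, map_one, map_ofNat]

/-- The sum over increasing tuples of products of `a`, with exponents `k`, and of a power of `u`
at position `j`. -/
def orderedSum (a : ℕ → R) (N : ℕ) (u : R) (r : ℕ) (k : Fin r → ℕ) (j : Fin r) : R :=
  ∑ n ∈ tuples r N, (∏ i, a (n i) ^ k i) * u ^ n j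

lemma mem_tuples {r N : ℕ} {n : Fin r → ℕ} :
    n ∈ tuples r N ↔ (∀ i, n i ∈ Finset.Ioo 0 N) ∧ ∀ i j, i < j → n i < n j := by
  simp only [tuples, Finset.mem_filter, Fintype.mem_piFinset]

lemma sum_tuples_two (N : ℕ) (F : ℕ → ℕ → R) :
    ∑ n ∈ tuples 2 N, F (n 0) (n 1)
      = ∑ x ∈ Finset.Ioo 0 N, ∑ y ∈ Finset.Ioo 0 N, if x < y then F x y else 0 := by
  trans ∑ q ∈ (Finset.Ioo 0 N ×ˢ Finset.Ioo 0 N).filter fun q => q.1 < q.2, F q.1 q.2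
  swap
  · simp only [Finset.sum_filter, Finset.sum_product]
  refine Finset.sum_nbij' (fun n => (n 0, n 1)) (fun q => ![q.1, q.2]) ?_ ?_ ?_ ?_ ?_
  · intro n hn
    rw [mem_tuples] at hn
    simp only [Finset.mem_filter, Finset.mem_product]
    exact ⟨⟨hn.1 _, hn.1 _⟩, hn.2 _ _ (by decide)⟩
  · rintro ⟨x, y⟩ hq
    simp only [Finset.mem_filter, Finset.mem_product] at hq
    simp only [mem_tuples, Fin.forall_fin_succ]
    simp [hq.1.1, hq.1.2, hq.2, - Finset.mem_Ioo]
  · intro n _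
    ext i; fin_cases i <;> rfl
  · intro q _; rfl
  · intro n _; rfl

lemma sum_tuples_three (N : ℕ) (F : ℕ → ℕ → ℕ → R) :
    ∑ n ∈ tuples 3 N, F (n 0) (n 1) (n 2)
      = ∑ x ∈ Finset.Ioo 0 N, ∑ y ∈ Finset.Ioo 0 N, ∑ z ∈ Finset.Ioo 0 N,
        if x < y ∧ y < z then F x y z else 0 := by
  trans ∑ q ∈ (Finset.Ioo 0 N ×ˢ Finset.Ioo 0 N ×ˢ Finset.Ioo 0 N).filter fun q => q.1 < q.2.1 ∧ q.2.1 < q.2.2, F q.1 q.2.1 q.2.2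
  swap
  · simp only [Finset.sum_filter, Finset.sum_product]
  refine Finset.sum_nbij' (fun n => (n 0, n 1, n 2)) (fun q => ![q.1, q.2.1, q.2.2]) ?_ ?_ ?_ ?_ ?_
  · intro n hn
    rw [mem_tuples] at hn
    simp only [Finset.mem_filter, Finset.mem_product]
    exact ⟨⟨hn.1 _, hn.1 _, hn.1 _⟩, hn.2 _ _ (by decide), hn.2 _ _ (by decide)⟩
  · rintro ⟨x, y, z⟩ hq
    simp only [Finset.mem_filter, Finset.mem_product] at hq
    obtain ⟨⟨hx, hy, hz⟩, hxy, hyz⟩ := hq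
    simp only [mem_tuples, Fin.forall_fin_succ]
    simp [hx, hy, hz, hxy, hyz, hxy.trans hyz, - Finset.mem_Ioo]
  · intro n _
    ext i; fin_cases i <;> rfl
  · intro q _; rfl
  · intro n _; rfl

lemma sum_tuples_four (N : ℕ) (F : ℕ → ℕ → ℕ → ℕ → R) :
    ∑ n ∈ tuples 4 N, F (n 0) (n 1) (n 2) (n 3)
      = ∑ x ∈ Finset.Ioo 0 N, ∑ y ∈ Finset.Ioo 0 N, ∑ z ∈ Finset.Ioo 0 N, ∑ w ∈ Finset.Ioo 0 N,
        if x < y ∧ y < z ∧ z < w then F x y z w else 0 := by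
  trans ∑ q ∈ (Finset.Ioo 0 N ×ˢ Finset.Ioo 0 N ×ˢ Finset.Ioo 0 N ×ˢ Finset.Ioo 0 N).filter fun q => q.1 < q.2.1 ∧ q.2.1 < q.2.2.1 ∧
      q.2.2.1 < q.2.2.2, F q.1 q.2.1 q.2.2.1 q.2.2.2
  swap
  · simp only [Finset.sum_filter, Finset.sum_product]
  refine Finset.sum_nbij' (fun n => (n 0, n 1, n 2, n 3))
    (fun q => ![q.1, q.2.1, q.2.2.1, q.2.2.2]) ?_ ?_ ?_ ?_ ?_
  · intro n hn
    rw [mem_tuples] at hn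
    simp only [Finset.mem_filter, Finset.mem_product]
    exact ⟨⟨hn.1 _, hn.1 _, hn.1 _, hn.1 _⟩, hn.2 _ _ (by decide), hn.2 _ _ (by decide),
      hn.2 _ _ (by decide)⟩
  · rintro ⟨x, y, z, w⟩ hq
    simp only [Finset.mem_filter, Finset.mem_product] at hq
    obtain ⟨⟨hx, hy, hz, hw⟩, hxy, hyz, hzw⟩ := hq
    simp only [mem_tuples, Fin.forall_fin_succ]
    simp [hx, hy, hz, hw, hxy, hyz, hzw, hxy.trans hyz, hyz.trans hzw, (hxy.trans hyz).trans hzw,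
      - Finset.mem_Ioo]
  · intro n _
    ext i; fin_cases i <;> rfl
  · intro q _; rfl
  · intro n _; rfl

/-- The sum over quadruples in `(0, N)` of `φ n x y z` times `a n * a x * a y * a z * u ^ n`. -/
def weightedSum (a : ℕ → R) (N : ℕ) (u : R) (φ : ℕ → ℕ → ℕ → ℕ → R) : R :=
  ∑ n ∈ Finset.Ioo 0 N, ∑ x ∈ Finset.Ioo 0 N, ∑ y ∈ Finset.Ioo 0 N, ∑ z ∈ Finset.Ioo 0 N,
    φ n x y z * (a x * a y * a z * a n * u ^ n)

section WeightedSum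

variable (a : ℕ → R) (N : ℕ) (u : R)

lemma weightedSum_add (φ ψ : ℕ → ℕ → ℕ → ℕ → R) :
    weightedSum a N u (fun n x y z => φ n x y z + ψ n x y z)
      = weightedSum a N u φ + weightedSum a N u ψ := by
  simp only [weightedSum, add_mul, Finset.sum_add_distrib]

lemma weightedSum_mul_left (c : R) (φ : ℕ → ℕ → ℕ → ℕ → R) :
    weightedSum a N u (fun n x y z => c * φ n x y z) = c * weightedSum a N u φ := by
  simp only [weightedSum, Finset.mul_sum, mul_assoc]

/-- The factor `a x * a y * a z` is symmetric, so a weight matters only through its symmetrization.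
-/
lemma weightedSum_symmetrize (φ : ℕ → ℕ → ℕ → ℕ → R) :
    weightedSum a N u (fun n => symmetrize (φ n)) = 6 * weightedSum a N u φ := by
  rw [weightedSum, weightedSum, Finset.mul_sum]
  refine Finset.sum_congr rfl fun n _ => ?_
  rw [← sum_symmetrize]
  refine Finset.sum_congr rfl fun x _ => Finset.sum_congr rfl fun y _ =>
    Finset.sum_congr rfl fun z _ => ?_
  simp only [symmetrize]
  ring

lemma orderedSum_four (j : Fin 4) : orderedSum a N u 4 ![1, 1, 1, 1] j
    = ∑ x ∈ Finset.Ioo 0 N, ∑ y ∈ Finset.Ioo 0 N, ∑ z ∈ Finset.Ioo 0 N, ∑ w ∈ Finset.Ioo 0 N,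
        if x < y ∧ y < z ∧ z < w then a x * a y * a z * a w * u ^ ![x, y, z, w] j else 0 := by
  rw [← sum_tuples_four N fun x y z w => a x * a y * a z * a w * u ^ ![x, y, z, w] j, orderedSum]
  refine Finset.sum_congr rfl fun n _ => ?_
  rw [show n j = ![n 0, n 1, n 2, n 3] j by fin_cases j <;> rfl]
  simp [Fin.prod_univ_four]

lemma orderedSum_three (k : Fin 3 → ℕ) (j : Fin 3) : orderedSum a N u 3 k j
    = ∑ x ∈ Finset.Ioo 0 N, ∑ y ∈ Finset.Ioo 0 N, ∑ z ∈ Finset.Ioo 0 N,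
        if x < y ∧ y < z then a x ^ k 0 * a y ^ k 1 * a z ^ k 2 * u ^ ![x, y, z] j else 0 := by
  rw [← sum_tuples_three N fun x y z => a x ^ k 0 * a y ^ k 1 * a z ^ k 2 * u ^ ![x, y, z] j,
    orderedSum]
  refine Finset.sum_congr rfl fun n _ => ?_
  rw [show n j = ![n 0, n 1, n 2] j by fin_cases j <;> rfl, Fin.prod_univ_three]

lemma orderedSum_two (k : Fin 2 → ℕ) (j : Fin 2) : orderedSum a N u 2 k j
    = ∑ x ∈ Finset.Ioo 0 N, ∑ y ∈ Finset.Ioo 0 N,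
        if x < y then a x ^ k 0 * a y ^ k 1 * u ^ ![x, y] j else 0 := by
  rw [← sum_tuples_two N fun x y => a x ^ k 0 * a y ^ k 1 * u ^ ![x, y] j, orderedSum]
  refine Finset.sum_congr rfl fun n _ => ?_
  rw [show n j = ![n 0, n 1] j by fin_cases j <;> rfl, Fin.prod_univ_two]

/-- Here and below, the variable carrying the power of `u` is moved to the outermost sum and called
`n`. -/
lemma orderedSum_four_zero : orderedSum a N u 4 ![1, 1, 1, 1] 0
    = weightedSum a N u fun n x y z => if n < x ∧ x < y ∧ y < z then 1 else 0 := by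
  rw [orderedSum_four, weightedSum]
  refine Finset.sum_congr rfl fun n _ => Finset.sum_congr rfl fun x _ =>
    Finset.sum_congr rfl fun y _ => Finset.sum_congr rfl fun z _ => ?_
  rw [ite_mul, zero_mul]
  exact if_congr Iff.rfl (by simp; ring) rfl

lemma orderedSum_four_one : orderedSum a N u 4 ![1, 1, 1, 1] 1
    = weightedSum a N u fun n x y z => if x < n ∧ n < y ∧ y < z then 1 else 0 := by
  rw [orderedSum_four, weightedSum, Finset.sum_comm]
  refine Finset.sum_congr rfl fun n _ => Finset.sum_congr rfl fun x _ =>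
    Finset.sum_congr rfl fun y _ => Finset.sum_congr rfl fun z _ => ?_
  rw [ite_mul, zero_mul]
  exact if_congr Iff.rfl (by simp; ring) rfl

lemma orderedSum_four_two : orderedSum a N u 4 ![1, 1, 1, 1] 2
    = weightedSum a N u fun n x y z => if x < y ∧ y < n ∧ n < z then 1 else 0 := by
  rw [orderedSum_four, weightedSum, Finset.sum_comm_cycle]
  refine Finset.sum_congr rfl fun n _ => Finset.sum_congr rfl fun x _ =>
    Finset.sum_congr rfl fun y _ => Finset.sum_congr rfl fun z _ => ?_
  rw [ite_mul, zero_mul]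
  exact if_congr Iff.rfl (by simp; ring) rfl

lemma orderedSum_four_three : orderedSum a N u 4 ![1, 1, 1, 1] 3
    = weightedSum a N u fun n x y z => if x < y ∧ y < z ∧ z < n then 1 else 0 := by
  rw [orderedSum_four, weightedSum, Finset.sum_congr rfl fun x _ => Finset.sum_comm_cycle,
    Finset.sum_comm]
  refine Finset.sum_congr rfl fun n _ => Finset.sum_congr rfl fun x _ =>
    Finset.sum_congr rfl fun y _ => Finset.sum_congr rfl fun z _ => ?_
  rw [ite_mul, zero_mul]
  exact if_congr Iff.rfl (by simp) rfl

lemma orderedSum_three_zero (k : Fin 3 → ℕ) : orderedSum a N u 3 k 0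
    = ∑ n ∈ Finset.Ioo 0 N, ∑ x ∈ Finset.Ioo 0 N, ∑ y ∈ Finset.Ioo 0 N,
        if n < x ∧ x < y then a x ^ k 1 * a y ^ k 2 * a n ^ k 0 * u ^ n else 0 := by
  rw [orderedSum_three]
  simp only [Matrix.cons_val, mul_comm, mul_assoc]

lemma orderedSum_three_one (k : Fin 3 → ℕ) : orderedSum a N u 3 k 1
    = ∑ n ∈ Finset.Ioo 0 N, ∑ x ∈ Finset.Ioo 0 N, ∑ y ∈ Finset.Ioo 0 N,
        if x < n ∧ n < y then a x ^ k 0 * a y ^ k 2 * a n ^ k 1 * u ^ n else 0 := by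
  rw [orderedSum_three, Finset.sum_comm]
  simp only [Matrix.cons_val, mul_comm, mul_left_comm, mul_assoc]

lemma orderedSum_three_two (k : Fin 3 → ℕ) : orderedSum a N u 3 k 2
    = ∑ n ∈ Finset.Ioo 0 N, ∑ x ∈ Finset.Ioo 0 N, ∑ y ∈ Finset.Ioo 0 N,
        if x < y ∧ y < n then a x ^ k 0 * a y ^ k 1 * a n ^ k 2 * u ^ n else 0 := by
  rw [orderedSum_three, Finset.sum_comm_cycle]
  rfl

lemma orderedSum_two_zero (k : Fin 2 → ℕ) : orderedSum a N u 2 k 0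
    = ∑ n ∈ Finset.Ioo 0 N, ∑ x ∈ Finset.Ioo 0 N,
        if n < x then a x ^ k 1 * a n ^ k 0 * u ^ n else 0 := by
  rw [orderedSum_two]
  simp only [Matrix.cons_val, mul_comm]

lemma orderedSum_two_one (k : Fin 2 → ℕ) : orderedSum a N u 2 k 1
    = ∑ n ∈ Finset.Ioo 0 N, ∑ x ∈ Finset.Ioo 0 N,
        if x < n then a x ^ k 0 * a n ^ k 1 * u ^ n else 0 := by
  rw [orderedSum_two, Finset.sum_comm]
  rfl

/-- Collapsing the last variable to `c n x y`. -/
lemma weightedSum_ite_eq {c : ℕ → ℕ → ℕ → ℕ}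
    (hc : ∀ n x y, n ∈ Finset.Ioo 0 N → x ∈ Finset.Ioo 0 N → y ∈ Finset.Ioo 0 N →
      c n x y ∈ Finset.Ioo 0 N) (P : ℕ → ℕ → ℕ → Prop) [∀ n x y, Decidable (P n x y)] :
    weightedSum a N u (fun n x y z => if z = c n x y then if P n x y then 1 else 0 else 0)
      = ∑ n ∈ Finset.Ioo 0 N, ∑ x ∈ Finset.Ioo 0 N, ∑ y ∈ Finset.Ioo 0 N,
        if P n x y then a x * a y * a (c n x y) * a n * u ^ n else 0 := by
  refine Finset.sum_congr rfl fun n hn => Finset.sum_congr rfl fun x hx =>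
    Finset.sum_congr rfl fun y hy => ?_
  simp only [ite_mul, one_mul, zero_mul]
  rw [Finset.sum_ite_eq', if_pos (hc n x y hn hx hy)]

lemma weightedSum_ite_eq_ite_eq (P : ℕ → ℕ → Prop) [∀ n x, Decidable (P n x)] :
    weightedSum a N u (fun n x y z => if z = n then if y = x then if P n x then 1 else 0 else 0
        else 0)
      = ∑ n ∈ Finset.Ioo 0 N, ∑ x ∈ Finset.Ioo 0 N,
        if P n x then a x ^ 2 * a n ^ 2 * u ^ n else 0 := by
  refine Finset.sum_congr rfl fun n hn => Finset.sum_congr rfl fun x hx => ?_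
  simp only [ite_mul, one_mul, zero_mul]
  have h (y : ℕ) : ∑ z ∈ Finset.Ioo 0 N, (if z = n then if y = x then if P n x then
      a x * a y * a z * a n * u ^ n else 0 else 0 else 0)
      = if y = x then if P n x then a x * a y * a n * a n * u ^ n else 0 else 0 := by
    rw [Finset.sum_ite_eq', if_pos hn]
  simp only [h]
  rw [Finset.sum_ite_eq', if_pos hx]
  exact if_congr Iff.rfl (by ring) rfl

lemma weightedSum_chamberWeight (T : R) :
    weightedSum a N u (chamberWeight T) = chamberSum T (orderedSum a N u) := by
  have hn : ∀ n x y, n ∈ Finset.Ioo 0 N → x ∈ Finset.Ioo 0 N → y ∈ Finset.Ioo 0 N →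
      n ∈ Finset.Ioo 0 N := fun _ _ _ h _ _ => h
  have hx : ∀ n x y, n ∈ Finset.Ioo 0 N → x ∈ Finset.Ioo 0 N → y ∈ Finset.Ioo 0 N →
      x ∈ Finset.Ioo 0 N := fun _ _ _ _ h _ => h
  have hy : ∀ n x y, n ∈ Finset.Ioo 0 N → x ∈ Finset.Ioo 0 N → y ∈ Finset.Ioo 0 N →
      y ∈ Finset.Ioo 0 N := fun _ _ _ _ _ h => h
  unfold chamberWeight
  simp only [weightedSum_add, weightedSum_mul_left]
  rw [chamberSum]
  simp only [weightedSum_ite_eq_ite_eq, weightedSum_ite_eq a N u hn,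
    weightedSum_ite_eq a N u hx, weightedSum_ite_eq a N u hy, orderedSum_three_zero,
    orderedSum_three_one, orderedSum_three_two, orderedSum_two_zero, orderedSum_two_one,
    orderedSum_four_zero, orderedSum_four_one, orderedSum_four_two, orderedSum_four_three,
    Matrix.cons_val, Matrix.cons_val_zero, Matrix.cons_val_one, pow_one, pow_two, mul_comm, mul_left_comm, mul_assoc]

end WeightedSum

/-- The descent weight and the chamber weight agree only after symmetrization in the first three
entries, whence the factor `6 = 3!`. -/
lemma six_mul_chainSum (a : ℕ → R) (T : R) (N : ℕ) (u : R) :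
    6 * chainSum a T N u 3 = 6 * chamberSum T (orderedSum a N u) := by
  have h : chainSum a T N u 3 = weightedSum a N u fun n x y z =>
      descentWeight T x y * descentWeight T y z * descentWeight T z n := by
    rw [chainSum, weightedSum]
    refine Finset.sum_congr rfl fun n _ => ?_
    -- The recursion for `chainCoeff` unfolds a chain from its last entry backwards, so `z` and then
    -- `y` are summed on the outside.
    rw [Finset.sum_comm_cycle, chainCoeff, Finset.mul_sum, Finset.sum_mul]
    refine Finset.sum_congr rfl fun z _ => ?_
    rw [Finset.sum_comm, chainCoeff, Finset.mul_sum, Finset.mul_sum, Finset.mul_sum, Finset.sum_mul]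
    refine Finset.sum_congr rfl fun y _ => ?_
    simp only [chainCoeff, Finset.mul_sum, Finset.sum_mul]
    exact Finset.sum_congr rfl fun x _ => by ring
  rw [h, ← weightedSum_chamberWeight, ← weightedSum_symmetrize, ← weightedSum_symmetrize]
  congr 1
  funext n x y z
  exact symmetrize_descentWeight T n x y z

end OrderedSums
end FMP

/-! ### Passage to the quotient ring -/

namespace FMP

section Adelic

lemma orderedSum_invC_eq (p : ℕ) [Fact p.Prime] {r : ℕ} (k : Fin r → ℕ) (j : Fin r)
    (u : (ZMod p)[X]) :
    ∑ n ∈ tuples r p, C (∏ i, ((n i : ZMod p) ^ k i)⁻¹) * u ^ n j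
      = orderedSum (invC p) p u r k j := by
  refine Finset.sum_congr rfl fun n _ => ?_
  simp only [invC, map_prod, ← inv_pow, map_pow]

/-- The value of `£*` with the argument `u` at position `j` and `1` elsewhere. -/
lemma star_update {r : ℕ} (k : Fin r → ℕ) (j : Fin r) (u : ℤ[X]) :
    star k (Function.update 1 j u)
      = mk fun p => orderedSum (invC p) p (u.map (Int.castRingHom (ZMod p))) r k j := by
  change mk _ = mk _
  congr 1
  funext p
  have : Fact (p : ℕ).Prime := ⟨p.2⟩
  rw [← orderedSum_invC_eq]
  change MvPolynomial.eval₂Hom _ _ (∑ n ∈ tuples r p, _) = _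
  rw [map_sum]
  refine Finset.sum_congr rfl fun n _ => ?_
  simp only [map_mul, map_prod, map_pow, MvPolynomial.eval₂Hom_C, MvPolynomial.eval₂Hom_X']
  congr 1
  rw [Finset.prod_eq_single j (fun i _ hi => by simp [Function.update_of_ne hi]) (by simp)]
  simp

/-- Once `6` is cancelled, both sides are chain sums, and reflection exchanges them because `(1 - X)
^ p = 1 - X ^ p`. -/
lemma chamberSum_reflect {p : ℕ} [Fact p.Prime] (h5 : 5 < p) :
    chamberSum (X ^ p) (orderedSum (invC p) p X)
      = chamberSum (1 - X ^ p) (orderedSum (invC p) p (1 - X)) := by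
  have h6 : (6 : (ZMod p)[X]) ≠ 0 := by
    have : ((6 : ℕ) : ZMod p) ≠ 0 := by
      rw [Ne, ZMod.natCast_eq_zero_iff]
      intro h
      have hp : p.Prime := Fact.out
      have := (Nat.Prime.dvd_mul hp (m := 2) (n := 3)).mp h
      rcases this with h | h <;> have := Nat.le_of_dvd (by norm_num) h <;> omega
    exact_mod_cast C_ne_zero.mpr this
  have key (T u : (ZMod p)[X]) : chamberSum T (orderedSum (invC p) p u)
      = chainSum (invC p) T p u 3 :=
    mul_left_cancel₀ h6 (six_mul_chainSum _ _ _ _).symm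
  have h := reflect_chainPoly_three h5
  rw [chainPoly, map_chainSum] at h
  simp only [map_pow, reflect_X, sub_pow_char, one_pow] at h
  rw [key, key, ← h]
  congr 1
  funext n
  simp [reflect, invC]

lemma mk_eq_mk_of_forall_gt {R : Nat.Primes → Type} [∀ p, CommRing (R p)] {f g : ∀ p, R p}
    (N : ℕ) (h : ∀ p : Nat.Primes, N < p → f p = g p) : mk f = mk g := by
  refine Ideal.Quotient.eq.mpr ?_
  refine Set.Finite.subset (s := {p : Nat.Primes | (p : ℕ) ≤ N})
    ((Set.finite_Iic N).preimage Subtype.val_injective.injOn) fun (p : Nat.Primes) hp => ?_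
  by_contra hN
  exact hp (sub_eq_zero.mpr (h p (not_le.mp hN)))

lemma chamberSum_mk (T : ∀ p : Nat.Primes, (ZMod p)[X])
    (S : ∀ r : ℕ, (Fin r → ℕ) → Fin r → ∀ p : Nat.Primes, (ZMod p)[X]) :
    chamberSum (mk T : APoly) (fun r k j => mk (S r k j))
      = mk fun p => chamberSum (T p) fun r k j => S r k j p := by
  refine (map_chamberSum (Ideal.Quotient.mk (finiteSupport fun p => (ZMod p)[X])) T S).symm.trans ?_
  refine congrArg mk ?_
  funext p
  exact map_chamberSum (Pi.evalRingHom (fun p : Nat.Primes => (ZMod p)[X]) p) T S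

lemma chamberSum_star : chamberSum tp (fun _ k j => star k (Function.update 1 j X))
    = chamberSum (1 - tp) (fun _ k j => star k (Function.update 1 j (1 - X))) := by
  have h1 : (1 - tp : APoly) = mk fun p => 1 - (X : (ZMod p)[X]) ^ (p : ℕ) := rfl
  rw [h1, tp]
  simp only [star_update, chamberSum_mk]
  refine mk_eq_mk_of_forall_gt 5 fun p hp => ?_
  have : Fact (p : ℕ).Prime := ⟨p.2⟩
  simpa using chamberSum_reflect hp

lemma polylog_eq {r : ℕ} (k : Fin (r + 1) → ℕ) (u : ℤ[X]) :
    polylog k u = star k (Function.update 1 (Fin.last r) u) := by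
  rw [polylog]
  congr 1
  ext1 i
  refine Fin.lastCases ?_ (fun i => ?_) i
  · simp
  · simp [Fin.castSucc_ne_last]

lemma tildePolylog_eq {r : ℕ} (k : Fin (r + 1) → ℕ) (u : ℤ[X]) :
    tildePolylog k u = star k (Function.update 1 0 u) := by
  rw [tildePolylog]
  congr 1
  ext1 i
  refine Fin.cases ?_ (fun i => ?_) i
  · simp
  · simp

end Adelic
end FMP

theorem corollary4p4 :
    (1 + 4 * FMP.tp + FMP.tp ^ 2) * FMP.polylog ![1, 1, 1, 1] X
      + 2 * FMP.tp * (2 + FMP.tp) * FMP.star ![1, 1, 1, 1] ![1, 1, X, 1]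
      + 2 * FMP.tp * (1 + 2 * FMP.tp) * FMP.star ![1, 1, 1, 1] ![1, X, 1, 1]
      + FMP.tp * (1 + 4 * FMP.tp + FMP.tp ^ 2) * FMP.tildePolylog ![1, 1, 1, 1] X
      + FMP.tp * (1 + 3 * FMP.tp) * FMP.tildePolylog ![2, 1, 1] X
      + 2 * FMP.tp * (1 + FMP.tp) * FMP.star ![1, 2, 1] ![1, X, 1]
      + FMP.tp * (3 + FMP.tp) * FMP.polylog ![1, 1, 2] X
      + FMP.tp * (FMP.polylog ![2, 1, 1] X + FMP.star ![2, 1, 1] ![1, X, 1]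
          + FMP.polylog ![1, 2, 1] X + FMP.polylog ![2, 2] X)
      + FMP.tp ^ 2 * (FMP.tildePolylog ![1, 1, 2] X + FMP.star ![1, 1, 2] ![1, X, 1]
          + FMP.tildePolylog ![1, 2, 1] X + FMP.tildePolylog ![2, 2] X)
    = (6 - 6 * FMP.tp + FMP.tp ^ 2) * FMP.polylog ![1, 1, 1, 1] (1 - X)
      + 2 * (1 - FMP.tp) * (3 - FMP.tp) * FMP.star ![1, 1, 1, 1] ![1, 1, 1 - X, 1]
      + 2 * (1 - FMP.tp) * (3 - 2 * FMP.tp) * FMP.star ![1, 1, 1, 1] ![1, 1 - X, 1, 1]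
      + (1 - FMP.tp) * (6 - 6 * FMP.tp + FMP.tp ^ 2) * FMP.tildePolylog ![1, 1, 1, 1] (1 - X)
      + (1 - FMP.tp) * (4 - 3 * FMP.tp) * FMP.tildePolylog ![2, 1, 1] (1 - X)
      + 2 * (1 - FMP.tp) * (2 - FMP.tp) * FMP.star ![1, 2, 1] ![1, 1 - X, 1]
      + (1 - FMP.tp) * (4 - FMP.tp) * FMP.polylog ![1, 1, 2] (1 - X)
      + (1 - FMP.tp) * (FMP.polylog ![2, 1, 1] (1 - X) + FMP.star ![2, 1, 1] ![1, 1 - X, 1]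
          + FMP.polylog ![1, 2, 1] (1 - X) + FMP.polylog ![2, 2] (1 - X))
      + (1 - FMP.tp) ^ 2 * (FMP.tildePolylog ![1, 1, 2] (1 - X)
          + FMP.star ![1, 1, 2] ![1, 1 - X, 1]
          + FMP.tildePolylog ![1, 2, 1] (1 - X) + FMP.tildePolylog ![2, 2] (1 - X)) := by
  have h := FMP.chamberSum_star
  have v₃ (u : ℤ[X]) : ![1, u, 1] = Function.update (1 : Fin 3 → ℤ[X]) 1 u := by
    ext1 i; fin_cases i <;> simp
  have v₁ (u : ℤ[X]) : ![1, u, 1, 1] = Function.update (1 : Fin 4 → ℤ[X]) 1 u := by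
    ext1 i; fin_cases i <;> simp
  have v₂ (u : ℤ[X]) : ![1, 1, u, 1] = Function.update (1 : Fin 4 → ℤ[X]) 2 u := by
    ext1 i; fin_cases i <;> simp
  have l₁ : Fin.last 1 = 1 := rfl
  have l₂ : Fin.last 2 = 2 := rfl
  have l₃ : Fin.last 3 = 3 := rfl
  simp only [FMP.polylog_eq, FMP.tildePolylog_eq, v₁, v₂, l₁, l₂, l₃]
  simp only [v₃]
  simp only [FMP.chamberSum] at h
  -- The coefficients on the right are those on the left with `1 - tp` for `tp`; for instance `1 + 4
  -- * (1 - tp) + (1 - tp) ^ 2 = 6 - 6 * tp + tp ^ 2`.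
  linear_combination h
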